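/- **Theorem 6.1 (Tsirelson, Glasner).** Let $(W,H,\mu)$ be an abstract Wiener space: $W$ is a separable real Banach space, $H$ is a separable real Hilbert space continuously, injectively and densely embedded in $W$, and $\mu$ is a Borel measure on $W$ under which every $e\in W^*$ is a $N(0,|e|_H^2)$ random variable, where $W^*\hookrightarrow H^*=H$. Call a measurable map $T:W\to W$ with $T_*\mu=\mu$ *measure preserving*, and call it *invertible* if there is a measure preserving map $S:W\to W$ with $S(Tw)=w$ and $T(Sw)=w$ for $\mu$-almost every $w$. 1. For every invertible measure preserving $T:W\to W$ there is a family $T_\theta:W\to W$, $\theta\in[0,1]$, of invertible measure preserving maps such that $T_0w=w$ and $T_1w=Tw$ for all $w\in W$, and for every $\theta\in[0,1]$ $$E\,|T_\eta w-T_\theta w|_W=\int_W|T_\eta w-T_\theta w|_W\,\mu(dw)\longrightarrow 0\qquad\text{as }\eta\to\theta,\ \eta\in[0,1].$$ 2. Hence the group, under composition, of invertible measure preserving maps of $W$ modulo $\mu$-almost everywhere equality, with the topology given by the metric $d(S,T)=E\,|Sw-Tw|_W$, is connected. -/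

import Mathlib

open MeasureTheory ProbabilityTheory Filter Topology
open scoped ENNReal NNReal unitInterval

/-- `(W, H, μ)` is an abstract Wiener space, the Hilbert space `H` being embedded in the Banach
space `W` by the continuous linear map `i`: the embedding is injective with dense range, and every
continuous linear functional `e` on `W` is, under `μ`, a centred normal variable of variance
`|e|_H ^ 2`. Here `|e|_H` is the norm of `e ∘ i` in `H* = H`. -/
structure IsAbstractWienerSpace {H W : Type*}
    [NormedAddCommGroup H] [InnerProductSpace ℝ H]
    [NormedAddCommGroup W] [NormedSpace ℝ W] [MeasurableSpace W]
    (i : H →L[ℝ] W) (μ : Measure W) : Prop where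
  injective : Function.Injective i
  denseRange : DenseRange i
  map_dual : ∀ e : W →L[ℝ] ℝ, μ.map e = gaussianReal 0 (‖e.comp i‖₊ ^ 2)

/-- An invertible rotation: a measure preserving transformation with a measure preserving
two-sided inverse up to null sets. -/
def IsInvertibleRotation {W : Type*} [MeasurableSpace W] (μ : Measure W) (T : W → W) : Prop :=
  MeasurePreserving T μ μ ∧
    ∃ S : W → W, MeasurePreserving S μ μ ∧ S ∘ T =ᵐ[μ] id ∧ T ∘ S =ᵐ[μ] id

namespace IsInvertibleRotation

variable {W : Type*} [MeasurableSpace W] {μ : Measure W}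

theorem refl_id (μ : Measure W) : IsInvertibleRotation μ (id : W → W) :=
  ⟨MeasurePreserving.id μ, id, MeasurePreserving.id μ, ae_eq_refl _, ae_eq_refl _⟩

theorem comp {T T' : W → W} (h : IsInvertibleRotation μ T) (h' : IsInvertibleRotation μ T') :
    IsInvertibleRotation μ (T ∘ T') := by
  obtain ⟨hT, S, hS, hST, hTS⟩ := h
  obtain ⟨hT', S', hS', hST', hTS'⟩ := h'
  refine ⟨hT.comp hT', S' ∘ S, hS'.comp hS, ?_, ?_⟩
  · filter_upwards [hT'.quasiMeasurePreserving.ae hST, hST'] with w h1 h2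
    simp only [Function.comp_apply, id] at *
    rw [h1, h2]
  · filter_upwards [hS.quasiMeasurePreserving.ae hTS', hTS] with w h1 h2
    simp only [Function.comp_apply, id] at *
    rw [h1, h2]

/-- An inverse, modulo null sets, of an invertible rotation. -/
noncomputable def inv {T : W → W} (h : IsInvertibleRotation μ T) : W → W := h.2.choose

theorem inv_comp {T : W → W} (h : IsInvertibleRotation μ T) : h.inv ∘ T =ᵐ[μ] id :=
  h.2.choose_spec.2.1

theorem comp_inv {T : W → W} (h : IsInvertibleRotation μ T) : T ∘ h.inv =ᵐ[μ] id :=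
  h.2.choose_spec.2.2

theorem isInvertibleRotation_inv {T : W → W} (h : IsInvertibleRotation μ T) :
    IsInvertibleRotation μ h.inv :=
  ⟨h.2.choose_spec.1, T, h.1, h.comp_inv, h.inv_comp⟩

theorem comp_congr {T T' S S' : W → W} (hS : IsInvertibleRotation μ S)
    (hT : T =ᵐ[μ] T') (hSS : S =ᵐ[μ] S') : T ∘ S =ᵐ[μ] T' ∘ S' := by
  filter_upwards [hS.1.quasiMeasurePreserving.ae hT, hSS] with w h1 h2
  simp only [Function.comp_apply]
  rw [h1, h2]

theorem inv_congr {T T' : W → W} (h : IsInvertibleRotation μ T) (h' : IsInvertibleRotation μ T')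
    (hT : T =ᵐ[μ] T') : h.inv =ᵐ[μ] h'.inv := by
  have hi := h.isInvertibleRotation_inv.1
  filter_upwards [hi.quasiMeasurePreserving.ae h'.inv_comp, hi.quasiMeasurePreserving.ae hT,
    h.comp_inv] with w h1 h2 h3
  simp only [Function.comp_apply, id] at *
  rw [← h2, h3] at h1
  exact h1.symm

end IsInvertibleRotation

/-- Two invertible rotations are identified when they agree almost everywhere. -/
def invertibleRotationSetoid {W : Type*} [MeasurableSpace W] (μ : Measure W) :
    Setoid {T : W → W // IsInvertibleRotation μ T} where
  r S T := S.1 =ᵐ[μ] T.1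
  iseqv := ⟨fun _ => ae_eq_refl _, fun h => h.symm, fun h h' => h.trans h'⟩

/-- The set of invertible rotations modulo almost everywhere equality. -/
def RotationGroup {W : Type*} [MeasurableSpace W] (μ : Measure W) : Type _ :=
  Quotient (invertibleRotationSetoid μ)

namespace RotationGroup

/-- The multiplication is composition of maps. -/
noncomputable instance instGroup {W : Type*} [MeasurableSpace W] (μ : Measure W) :
    Group (RotationGroup μ) where
  mul := Quotient.map₂ (fun S T => ⟨S.1 ∘ T.1, S.2.comp T.2⟩)
    (fun S S' h T T' h' =>
      IsInvertibleRotation.comp_congr (T := S.1) (T' := S'.1) (S' := T'.1) T.2 h h')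
  one := Quotient.mk _ ⟨id, IsInvertibleRotation.refl_id μ⟩
  inv := Quotient.map (fun T => ⟨T.2.inv, T.2.isInvertibleRotation_inv⟩)
    (fun S T h => S.2.inv_congr T.2 h)
  mul_assoc := by
    rintro ⟨a⟩ ⟨b⟩ ⟨c⟩
    rfl
  one_mul := by
    rintro ⟨a⟩
    rfl
  mul_one := by
    rintro ⟨a⟩
    rfl
  inv_mul_cancel := by
    rintro ⟨a⟩
    exact Quotient.sound a.2.inv_comp

/-- The distance `E |S w - T w|_W`; it induces the topology of the group. -/
noncomputable instance instEMetricSpace {W : Type*} [NormedAddCommGroup W] [MeasurableSpace W]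
    [BorelSpace W] [SecondCountableTopology W] (μ : Measure W) :
    EMetricSpace (RotationGroup μ) where
  edist := Quotient.lift₂ (fun S T => ∫⁻ w, ‖S.1 w - T.1 w‖ₑ ∂μ) (by
    intro S T S' T' h h'
    refine lintegral_congr_ae ?_
    have h : S.1 =ᵐ[μ] S'.1 := h
    have h' : T.1 =ᵐ[μ] T'.1 := h'
    filter_upwards [h, h'] with w h1 h2
    rw [h1, h2])
  edist_self := by
    rintro ⟨a⟩
    change ∫⁻ w, ‖a.1 w - a.1 w‖ₑ ∂μ = 0
    simp
  edist_comm := by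
    rintro ⟨a⟩ ⟨b⟩
    refine lintegral_congr fun w => ?_
    exact enorm_sub_rev _ _
  edist_triangle := by
    rintro ⟨a⟩ ⟨b⟩ ⟨c⟩
    have hm : Measurable fun w => ‖a.1 w - b.1 w‖ₑ :=
      (a.2.1.measurable.sub b.2.1.measurable).enorm
    change ∫⁻ w, ‖a.1 w - c.1 w‖ₑ ∂μ ≤
      ∫⁻ w, ‖a.1 w - b.1 w‖ₑ ∂μ + ∫⁻ w, ‖b.1 w - c.1 w‖ₑ ∂μ
    rw [← lintegral_add_left hm]
    refine lintegral_mono fun w => ?_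
    rw [← sub_add_sub_cancel (a.1 w) (b.1 w) (c.1 w)]
    exact enorm_add_le _ _
  eq_of_edist_eq_zero := by
    rintro ⟨a⟩ ⟨b⟩ h
    have hm : Measurable fun w => ‖a.1 w - b.1 w‖ₑ :=
      (a.2.1.measurable.sub b.2.1.measurable).enorm
    change ∫⁻ w, ‖a.1 w - b.1 w‖ₑ ∂μ = 0 at h
    rw [lintegral_eq_zero_iff hm] at h
    refine Quotient.sound ?_
    change a.1 =ᵐ[μ] b.1
    filter_upwards [h] with w hw
    simpa [sub_eq_zero] using hw

end RotationGroup

/-! Write `T_A` for the map that `T` induces on `A`. By Poincaré recurrence it is again an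
invertible rotation, with inverse `S_A` if `S` inverts `T` (`IsInvertibleRotation.inducedMap`);
moreover `T_∅ = id` and `T_W = T`. If `A ⊆ B`, then almost everywhere `T_A` and `T_B` can differ
only on `B \ A` or where `T_B` lands in `B \ A`, so they differ on a set of measure at most `2 * μ
(B \ A)` (`measure_inducedMap_ne_le`). Hence the maps induced on the sets `{g < θ}` form a path from
`id` to `T` that is continuous for `μ {R ≠ R'}`, as soon as `g` has values in `[0, 1)` and a law
without atoms. A nondegenerate Gaussian functional squeezed into `(0, 1)` is such a `g`. Since `‖w‖`
is integrable for a Gaussian measure, rotations composed with the norm are uniformly integrable, and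
the continuity passes to `L¹` (`tendsto_lintegral_enorm_sub`). The paths from the identity make the
group path connected. -/

/-- The points of `A` that come back to `A` under `T` at time `n + 1` for the first time. -/
def firstReturnSet {X : Type*} (T : X → X) (A : Set X) (n : ℕ) : Set X :=
  {x | x ∈ A ∧ T^[n + 1] x ∈ A ∧ ∀ k < n, T^[k + 1] x ∉ A}

open Classical in
/-- The transformation induced by `T` on `A`: a point of `A` is sent to the first point of its
orbit that lies in `A`, and the points outside `A` (or that never come back to `A`) are fixed. -/
noncomputable def inducedMap {X : Type*} (T : X → X) (A : Set X) (x : X) : X :=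
  if h : x ∈ A ∧ ∃ n, T^[n + 1] x ∈ A then T^[Nat.find h.2 + 1] x else x

/-! ### Induced transformations. -/

section Induced

variable {X : Type*} {T : X → X} {A : Set X} {x : X} {n : ℕ}

theorem inducedMap_of_mem (h : x ∈ firstReturnSet T A n) : inducedMap T A x = T^[n + 1] x := by
  classical
  have hx : x ∈ A ∧ ∃ n, T^[n + 1] x ∈ A := ⟨h.1, n, h.2.1⟩
  have hn : Nat.find hx.2 = n := (Nat.find_eq_iff hx.2).2 ⟨h.2.1, h.2.2⟩
  rw [inducedMap, dif_pos hx, hn]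

theorem exists_mem_firstReturnSet (hx : x ∈ A) (h : ∃ n, T^[n + 1] x ∈ A) :
    ∃ n, x ∈ firstReturnSet T A n := by
  classical
  exact ⟨Nat.find h, hx, Nat.find_spec h, fun _ hk => Nat.find_min h hk⟩

theorem inducedMap_of_forall_notMem (h : ∀ n, x ∉ firstReturnSet T A n) :
    inducedMap T A x = x := by
  rw [inducedMap, dif_neg]
  rintro ⟨hx, hn⟩
  obtain ⟨n, hn⟩ := exists_mem_firstReturnSet hx hn
  exact h n hn

theorem inducedMap_of_notMem (hx : x ∉ A) : inducedMap T A x = x :=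
  inducedMap_of_forall_notMem fun _ h => hx h.1

theorem inducedMap_mem_iff : inducedMap T A x ∈ A ↔ x ∈ A := by
  by_cases h : ∃ n, x ∈ firstReturnSet T A n
  · obtain ⟨n, hn⟩ := h
    rw [inducedMap_of_mem hn]
    exact iff_of_true hn.2.1 hn.1
  · rw [inducedMap_of_forall_notMem (not_exists.1 h)]

theorem inducedMap_empty (T : X → X) : inducedMap T ∅ = id :=
  funext fun x => inducedMap_of_notMem (Set.notMem_empty x)

theorem inducedMap_univ (T : X → X) : inducedMap T Set.univ = T :=
  funext fun x => inducedMap_of_mem (n := 0) ⟨trivial, trivial, by simp⟩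

theorem pairwise_disjoint_firstReturnSet (T : X → X) (A : Set X) :
    Pairwise (Function.onFun Disjoint (firstReturnSet T A)) := by
  refine (pairwise_disjoint_on _).2 fun m n hmn => Set.disjoint_left.2 fun x hm hn => ?_
  exact hn.2.2 m hmn hm.2.1

theorem preimage_inducedMap (T : X → X) (A B : Set X) :
    inducedMap T A ⁻¹' B = (⋃ n, firstReturnSet T A n ∩ T^[n + 1] ⁻¹' B) ∪
      (B \ ⋃ n, firstReturnSet T A n) := by
  ext x
  by_cases h : ∃ n, x ∈ firstReturnSet T A n
  · obtain ⟨n, hn⟩ := h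
    simp only [Set.mem_preimage, inducedMap_of_mem hn, Set.mem_union, Set.mem_iUnion,
      Set.mem_inter_iff, Set.mem_sdiff]
    refine ⟨fun hB => Or.inl ⟨n, hn, hB⟩, ?_⟩
    rintro (⟨m, hm, hB⟩ | ⟨-, h⟩)
    · rwa [← inducedMap_of_mem hn, inducedMap_of_mem hm]
    · exact absurd ⟨n, hn⟩ h
  · have h' := not_exists.1 h
    simp only [Set.mem_preimage, inducedMap_of_forall_notMem h', Set.mem_union, Set.mem_iUnion,
      Set.mem_inter_iff, Set.mem_sdiff]
    simp [h']

/-- If `S` inverts `T`, a first return of `T` run backwards is a first return of `S`. -/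
theorem iterate_mem_firstReturnSet {S : X → X} (hx : ∀ k j, S^[k] (T^[k + j] x) = T^[j] x)
    (h : x ∈ firstReturnSet T A n) : T^[n + 1] x ∈ firstReturnSet S A n := by
  refine ⟨h.2.1, ?_, fun k hk => ?_⟩
  · have := hx (n + 1) 0
    rw [add_zero] at this
    rw [this]
    exact h.1
  · have := hx (k + 1) (n - k)
    -- Since `k < n`, the backward orbit is at the time `n - k ≥ 1` of the forward one, strictly
    -- before the return.
    rw [show k + 1 + (n - k) = n + 1 by omega] at this
    rw [this, show n - k = n - k - 1 + 1 by omega]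
    exact h.2.2 _ (by omega)

variable [MeasurableSpace X]

theorem measurableSet_firstReturnSet (hT : Measurable T) (hA : MeasurableSet A) (n : ℕ) :
    MeasurableSet (firstReturnSet T A n) := by
  have h : firstReturnSet T A n =
      A ∩ (T^[n + 1] ⁻¹' A ∩ ⋂ k, ⋂ (_ : k < n), (T^[k + 1] ⁻¹' A)ᶜ) := by
    ext x
    simp only [firstReturnSet, Set.mem_ofPred_eq, Set.mem_inter_iff, Set.mem_preimage, Set.mem_iInter,
      Set.mem_compl_iff]
  rw [h]
  exact hA.inter (((hT.iterate _) hA).inter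
    (.iInter fun k => .iInter fun _ => ((hT.iterate _) hA).compl))

theorem measurable_inducedMap (hT : Measurable T) (hA : MeasurableSet A) :
    Measurable (inducedMap T A) := by
  intro B hB
  rw [preimage_inducedMap]
  have h := measurableSet_firstReturnSet hT hA
  exact (MeasurableSet.iUnion fun n => (h n).inter ((hT.iterate _) hB)).union
    (hB.diff (.iUnion h))

variable {μ : Measure X} {S : X → X}

/-- `S` inverts `T` only off a null set; its preimages under the iterates of `T` are null, so one
null set serves all times. -/
theorem ae_iterate_cancel (hT : MeasurePreserving T μ μ) (hST : S ∘ T =ᵐ[μ] id) :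
    ∀ᵐ x ∂μ, ∀ k j, S^[k] (T^[k + j] x) = T^[j] x := by
  have h : ∀ᵐ x ∂μ, ∀ j, S (T^[j + 1] x) = T^[j] x := ae_all_iff.2 fun j => by
    filter_upwards [(hT.iterate j).quasiMeasurePreserving.ae hST] with x hx
    rw [Function.iterate_succ_apply']
    exact hx
  filter_upwards [h] with x hx k
  induction k with
  | zero => intro j; simp
  | succ k ih =>
    intro j
    rw [Function.iterate_succ_apply, show k + 1 + j = k + j + 1 by ring, hx, ih]

theorem inducedMap_comp_inducedMap (hT : MeasurePreserving T μ μ) (hST : S ∘ T =ᵐ[μ] id)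
    (A : Set X) (hrec : ∀ᵐ x ∂μ, x ∈ A → ∃ n, T^[n + 1] x ∈ A) :
    inducedMap S A ∘ inducedMap T A =ᵐ[μ] id := by
  filter_upwards [ae_iterate_cancel hT hST, hrec] with x hx hr
  rw [Function.comp_apply, id]
  by_cases hA : x ∈ A
  · obtain ⟨n, hn⟩ := exists_mem_firstReturnSet hA (hr hA)
    rw [inducedMap_of_mem hn, inducedMap_of_mem (iterate_mem_firstReturnSet hx hn)]
    exact hx (n + 1) 0
  · rw [inducedMap_of_notMem hA, inducedMap_of_notMem hA]

/-- Poincaré recurrence. -/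
theorem ae_exists_iterate_mem [IsFiniteMeasure μ] (hT : MeasurePreserving T μ μ)
    (hA : MeasurableSet A) : ∀ᵐ x ∂μ, x ∈ A → ∃ n, T^[n + 1] x ∈ A := by
  filter_upwards [hT.conservative.ae_mem_imp_frequently_image_mem hA.nullMeasurableSet] with x hx h
  obtain ⟨n, hn, h⟩ := (frequently_atTop.1 (hx h)) 1
  exact ⟨n - 1, by rwa [Nat.sub_add_cancel hn]⟩

/-- A point that returns after `n + 1` steps lands in `firstReturnSet S A n`. These sets are
disjoint in `n` and contained in `A`, so the pieces of the preimage have total measure at most `μ (B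
∩ A)`. -/
theorem measure_preimage_inducedMap_le [IsFiniteMeasure μ] (hT : MeasurePreserving T μ μ)
    (hS : Measurable S) (hST : S ∘ T =ᵐ[μ] id) (hA : MeasurableSet A) {B : Set X}
    (hB : MeasurableSet B) : μ (inducedMap T A ⁻¹' B) ≤ μ B := by
  have hE := measurableSet_firstReturnSet hS hA
  have hsub : inducedMap T A ⁻¹' B ≤ᵐ[μ]
      ((⋃ n, T^[n + 1] ⁻¹' (B ∩ firstReturnSet S A n)) ∪ (B \ A) : Set X) := by
    filter_upwards [ae_iterate_cancel hT hST, ae_exists_iterate_mem hT hA] with x hx hr hB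
    have hB : inducedMap T A x ∈ B := hB
    by_cases hxA : x ∈ A
    · obtain ⟨n, hn⟩ := exists_mem_firstReturnSet hxA (hr hxA)
      rw [inducedMap_of_mem hn] at hB
      exact Or.inl (Set.mem_iUnion.2 ⟨n, hB, iterate_mem_firstReturnSet hx hn⟩)
    · rw [inducedMap_of_notMem hxA] at hB
      exact Or.inr ⟨hB, hxA⟩
  calc μ (inducedMap T A ⁻¹' B)
      ≤ μ ((⋃ n, T^[n + 1] ⁻¹' (B ∩ firstReturnSet S A n)) ∪ (B \ A)) := measure_mono_ae hsub
    _ ≤ μ (⋃ n, T^[n + 1] ⁻¹' (B ∩ firstReturnSet S A n)) + μ (B \ A) := measure_union_le _ _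
    _ ≤ (∑' n, μ (T^[n + 1] ⁻¹' (B ∩ firstReturnSet S A n))) + μ (B \ A) := by
      gcongr
      exact measure_iUnion_le _
    _ = (∑' n, μ (B ∩ firstReturnSet S A n)) + μ (B \ A) := by
      congr 1
      exact tsum_congr fun n =>
        (hT.iterate (n + 1)).measure_preimage (hB.inter (hE n)).nullMeasurableSet
    _ = μ (⋃ n, B ∩ firstReturnSet S A n) + μ (B \ A) := by
      rw [measure_iUnion (fun m n hmn => ((pairwise_disjoint_firstReturnSet S A hmn).mono
        Set.inter_subset_right Set.inter_subset_right)) fun n => hB.inter (hE n)]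
    _ ≤ μ (B ∩ A) + μ (B \ A) := by
      gcongr
      exact Set.iUnion_subset fun n => Set.inter_subset_inter_right _ fun x hx => hx.1
    _ = μ B := measure_inter_add_sdiff B hA

/-- A measure dominated by a finite measure of the same total mass equals it, so one inequality is
enough. -/
theorem measurePreserving_of_measure_preimage_le [IsFiniteMeasure μ] {f : X → X}
    (hf : Measurable f) (h : ∀ B, MeasurableSet B → μ (f ⁻¹' B) ≤ μ B) :
    MeasurePreserving f μ μ := by
  refine ⟨hf, Measure.eq_of_le_of_measure_univ_eq ?_ ?_⟩
  · exact Measure.le_iff.2 fun B hB => by rw [Measure.map_apply hf hB]; exact h B hB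
  · rw [Measure.map_apply hf .univ, Set.preimage_univ]

theorem IsInvertibleRotation.inducedMap [IsFiniteMeasure μ] (h : IsInvertibleRotation μ T)
    (hA : MeasurableSet A) : IsInvertibleRotation μ (inducedMap T A) := by
  obtain ⟨hT, S, hS, hST, hTS⟩ := h
  refine ⟨measurePreserving_of_measure_preimage_le (measurable_inducedMap hT.measurable hA)
      fun B hB => measure_preimage_inducedMap_le hT hS.measurable hST hA hB,
    _root_.inducedMap S A,
    measurePreserving_of_measure_preimage_le (measurable_inducedMap hS.measurable hA)
      fun B hB => measure_preimage_inducedMap_le hS hT.measurable hTS hA hB, ?_, ?_⟩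
  · exact inducedMap_comp_inducedMap hT hST A (ae_exists_iterate_mem hT hA)
  · exact inducedMap_comp_inducedMap hS hTS A (ae_exists_iterate_mem hS hA)

/-- The induced map depends continuously on the set, for the uniform distance. -/
theorem measure_inducedMap_ne_le [IsFiniteMeasure μ] (h : IsInvertibleRotation μ T)
    {A B : Set X} (hA : MeasurableSet A) (hB : MeasurableSet B) (hAB : A ⊆ B) :
    μ {x | inducedMap T A x ≠ inducedMap T B x} ≤ 2 * μ (B \ A) := by
  have hsub : ({x | inducedMap T A x ≠ inducedMap T B x} : Set X) ≤ᵐ[μ]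
      (inducedMap T B ⁻¹' (B \ A) ∪ (B \ A) : Set X) := by
    filter_upwards [ae_exists_iterate_mem h.1 hA] with x hr hne
    have hne : inducedMap T A x ≠ inducedMap T B x := hne
    by_cases hxB : x ∈ B
    · by_cases hxA : x ∈ A
      · refine Or.inl ⟨inducedMap_mem_iff.2 hxB, fun hmem => hne ?_⟩
        obtain ⟨n, hn⟩ := exists_mem_firstReturnSet hxA (hr hxA)
        obtain ⟨m, hm⟩ := exists_mem_firstReturnSet hxB ⟨n, hAB hn.2.1⟩
        rw [inducedMap_of_mem hm] at hmem
        -- A first return to `B` that falls in `A` is also the first return to `A`.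
        have hmn : m = n := le_antisymm
          (not_lt.1 fun hlt => hm.2.2 n hlt (hAB hn.2.1)) (not_lt.1 fun hlt => hn.2.2 m hlt hmem)
        rw [inducedMap_of_mem hn, inducedMap_of_mem hm, hmn]
      · exact Or.inr ⟨hxB, hxA⟩
    · exact absurd ((inducedMap_of_notMem fun hxA => hxB (hAB hxA)).trans
        (inducedMap_of_notMem hxB).symm) hne
  calc μ {x | inducedMap T A x ≠ inducedMap T B x}
      ≤ μ (inducedMap T B ⁻¹' (B \ A) ∪ (B \ A)) := measure_mono_ae hsub
    _ ≤ μ (inducedMap T B ⁻¹' (B \ A)) + μ (B \ A) := measure_union_le _ _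
    _ = 2 * μ (B \ A) := by
      rw [(h.inducedMap hB).1.measure_preimage (hB.diff hA).nullMeasurableSet, two_mul]

end Induced

/-! ### From the uniform distance to `L¹`. -/

/-- The functions `f ∘ R`, for `f` integrable and `R` measure preserving, are uniformly
integrable. -/
theorem exists_pos_setLIntegral_comp_le {X : Type*} [MeasurableSpace X] {μ : Measure X}
    {f : X → ℝ≥0∞} (hf : Measurable f) (hfin : ∫⁻ x, f x ∂μ ≠ ∞) {ε : ℝ≥0∞} (hε : 0 < ε) :
    ∃ δ > 0, ∀ R : X → X, MeasurePreserving R μ μ → ∀ D : Set X, μ D < δ →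
      ∫⁻ x in D, f (R x) ∂μ ≤ ε := by
  have hlim : Tendsto (fun n : ℕ => ∫⁻ x, (f x - n) ∂μ) atTop (𝓝 (∫⁻ _, 0 ∂μ)) := by
    refine tendsto_lintegral_of_dominated_convergence f (fun n => hf.sub_const _)
      (fun n => ae_of_all _ fun x => tsub_le_self) hfin ?_
    filter_upwards [ae_lt_top hf hfin] with x hx
    obtain ⟨N, hN⟩ := ENNReal.exists_nat_gt hx.ne
    refine tendsto_const_nhds.congr' ?_
    filter_upwards [eventually_ge_atTop N] with n hn
    exact (tsub_eq_zero_of_le (hN.le.trans (Nat.cast_le.2 hn))).symm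
  rw [lintegral_zero] at hlim
  have hε2 : 0 < ε / 2 := ENNReal.half_pos hε.ne'
  obtain ⟨n, hn⟩ := (hlim.eventually_lt_const hε2).exists
  -- The level `n` does not depend on `R`, because the integral of `f ∘ R - n` is that of `f - n`.
  -- If `n = 0`, the quotient is `∞`, which is harmless.
  refine ⟨ε / 2 / n, ENNReal.div_pos hε2.ne' (ENNReal.natCast_ne_top n), fun R hR D hD => ?_⟩
  calc ∫⁻ x in D, f (R x) ∂μ
      ≤ ∫⁻ x in D, (n + (f (R x) - n)) ∂μ := lintegral_mono fun x => le_add_tsub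
    _ = n * μ D + ∫⁻ x in D, (f (R x) - n) ∂μ := by
      rw [lintegral_add_left measurable_const, setLIntegral_const]
    _ ≤ n * (ε / 2 / n) + ∫⁻ x, (f (R x) - n) ∂μ := by
      gcongr
      exact Measure.restrict_le_self
    _ ≤ ε / 2 + ε / 2 := by
      gcongr
      · exact ENNReal.mul_div_le
      · rw [hR.lintegral_comp (hf.sub_const (n : ℝ≥0∞))]
        exact hn.le
    _ = ε := ENNReal.add_halves ε

/-- For measure preserving maps, `L¹` convergence follows from convergence in the uniform
distance `μ {R ≠ R'}`. -/
theorem tendsto_lintegral_enorm_sub {W ι : Type*} [NormedAddCommGroup W] [MeasurableSpace W]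
    [BorelSpace W] [SecondCountableTopology W] {μ : Measure W} (hint : ∫⁻ w, ‖w‖ₑ ∂μ ≠ ∞)
    {l : Filter ι} {R : ι → W → W} {R₀ : W → W} (hR : ∀ j, MeasurePreserving (R j) μ μ)
    (hR₀ : MeasurePreserving R₀ μ μ) (h : Tendsto (fun j => μ {w | R j w ≠ R₀ w}) l (𝓝 0)) :
    Tendsto (fun j => ∫⁻ w, ‖R j w - R₀ w‖ₑ ∂μ) l (𝓝 0) := by
  refine ENNReal.tendsto_nhds_zero.2 fun ε hε => ?_
  obtain ⟨δ, hδ, H⟩ := exists_pos_setLIntegral_comp_le (μ := μ) measurable_enorm hint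
    (ENNReal.half_pos hε.ne')
  filter_upwards [h.eventually_lt_const hδ] with j hj
  set D := {w | R j w ≠ R₀ w}
  have hsupp : Function.support (fun w => ‖R j w - R₀ w‖ₑ) ⊆ D := fun w hw heq =>
    hw (by simp [heq])
  calc ∫⁻ w, ‖R j w - R₀ w‖ₑ ∂μ
      = ∫⁻ w in D, ‖R j w - R₀ w‖ₑ ∂μ := (setLIntegral_eq_of_support_subset hsupp).symm
    _ ≤ ∫⁻ w in D, (‖R j w‖ₑ + ‖R₀ w‖ₑ) ∂μ := lintegral_mono fun w => enorm_sub_le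
    _ = (∫⁻ w in D, ‖R j w‖ₑ ∂μ) + ∫⁻ w in D, ‖R₀ w‖ₑ ∂μ :=
      lintegral_add_left (hR j).measurable.enorm _
    _ ≤ ε / 2 + ε / 2 := add_le_add (H _ (hR j) D hj) (H _ hR₀ D hj)
    _ = ε := ENNReal.add_halves ε

/-- Continuity from above: the closed neighbourhoods of `c` shrink to `{c}`, which is null for the
law of `g`. -/
theorem tendsto_measure_preimage_closedBall {X : Type*} [MeasurableSpace X] {μ : Measure X}
    [IsFiniteMeasure μ] {g : X → ℝ} (hg : Measurable g) (c : ℝ) (h : μ (g ⁻¹' {c}) = 0) :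
    Tendsto (fun r => μ (g ⁻¹' Metric.cthickening r {c})) (𝓝 0) (𝓝 0) := by
  have := tendsto_measure_cthickening_of_isClosed (μ := μ.map g) (s := {c})
    ⟨1, one_pos, measure_ne_top _ _⟩ isClosed_singleton
  rw [Measure.map_apply hg (measurableSet_singleton c), h] at this
  refine this.congr fun r => ?_
  rw [Measure.map_apply hg Metric.isClosed_cthickening.measurableSet]

/-- An invertible rotation is joined to the identity by the maps it induces on the sublevel sets
of a function without atoms. -/
theorem exists_path_of_measure_fiber_eq_zero {W : Type*} [NormedAddCommGroup W]
    [MeasurableSpace W] [BorelSpace W] [SecondCountableTopology W] {μ : Measure W}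
    [IsFiniteMeasure μ] (hint : ∫⁻ w, ‖w‖ₑ ∂μ ≠ ∞) {g : W → ℝ} (hg : Measurable g)
    (hg0 : ∀ w, 0 ≤ g w) (hg1 : ∀ w, g w < 1) (hfib : ∀ c, μ (g ⁻¹' {c}) = 0)
    {T : W → W} (hT : IsInvertibleRotation μ T) :
    ∃ R : I → W → W, (∀ θ : I, IsInvertibleRotation μ (R θ)) ∧ R 0 = id ∧ R 1 = T ∧
      ∀ θ : I, Tendsto (fun η : I => ∫⁻ w, ‖R η w - R θ w‖ₑ ∂μ) (𝓝 θ) (𝓝 0) := by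
  have hA : ∀ θ : I, MeasurableSet {w | g w < θ} := fun θ => measurableSet_lt hg measurable_const
  have hR := fun θ : I => hT.inducedMap (hA θ)
  refine ⟨fun θ => inducedMap T {w | g w < θ}, hR, ?_, ?_, fun θ => ?_⟩
  · have : {w | g w < ((0 : I) : ℝ)} = ∅ := by
      ext w
      simpa using hg0 w
    simp only [this, inducedMap_empty]
  · have : {w | g w < ((1 : I) : ℝ)} = Set.univ := by
      ext w
      simpa using hg1 w
    simp only [this, inducedMap_univ]
  refine tendsto_lintegral_enorm_sub hint (fun η => (hR η).1) (hR θ).1 ?_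
  have hdist : Tendsto (fun η : I => dist (η : ℝ) θ) (𝓝 θ) (𝓝 0) := by
    have : Continuous fun η : I => dist (η : ℝ) θ := by fun_prop
    simpa using this.tendsto θ
  have hlim := ENNReal.Tendsto.const_mul (a := 2)
    ((tendsto_measure_preimage_closedBall hg θ (hfib θ)).comp hdist) (Or.inr (by simp))
  rw [mul_zero] at hlim
  refine tendsto_of_tendsto_of_tendsto_of_le_of_le tendsto_const_nhds hlim
    (fun _ => zero_le) fun η => ?_
  simp only [Function.comp_apply, Metric.cthickening_singleton _ dist_nonneg]
  -- In both cases the difference of the sublevel sets lies where `g` is within `|η - θ|` of `θ`.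
  rcases le_total (η : ℝ) θ with hle | hle
  · refine (measure_inducedMap_ne_le hT (hA η) (hA θ) fun w hw => lt_of_lt_of_le hw hle).trans ?_
    gcongr
    rintro w ⟨h1, h2⟩
    have h1 : g w < θ := h1
    have h2 : (η : ℝ) ≤ g w := not_lt.1 h2
    rw [Set.mem_preimage, Metric.mem_closedBall, dist_comm (η : ℝ), Real.dist_eq, Real.dist_eq,
      abs_of_nonpos (by linarith), abs_of_nonneg (by linarith)]
    linarith
  · simp only [ne_comm (a := inducedMap T {w | g w < (η : ℝ)} _)]
    refine (measure_inducedMap_ne_le hT (hA θ) (hA η) fun w hw => lt_of_lt_of_le hw hle).trans ?_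
    gcongr
    rintro w ⟨h1, h2⟩
    have h1 : g w < η := h1
    have h2 : (θ : ℝ) ≤ g w := not_lt.1 h2
    rw [Set.mem_preimage, Metric.mem_closedBall, Real.dist_eq, Real.dist_eq,
      abs_of_nonneg (by linarith), abs_of_nonneg (by linarith)]
    linarith

/-! ### Gaussian input and conclusion. -/

theorem IsAbstractWienerSpace.isGaussian {H W : Type*}
    [NormedAddCommGroup H] [InnerProductSpace ℝ H]
    [NormedAddCommGroup W] [NormedSpace ℝ W] [MeasurableSpace W] [BorelSpace W]
    {i : H →L[ℝ] W} {μ : Measure W} (hμ : IsAbstractWienerSpace i μ) : IsGaussian μ :=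
  isGaussian_of_map_eq_gaussianReal fun e => ⟨_, _, hμ.map_dual e⟩

/-- On a nontrivial abstract Wiener space some continuous linear functional has a nondegenerate
normal law. -/
theorem IsAbstractWienerSpace.exists_dual_measure_fiber_eq_zero {H W : Type*}
    [NormedAddCommGroup H] [InnerProductSpace ℝ H]
    [NormedAddCommGroup W] [NormedSpace ℝ W] [MeasurableSpace W] [BorelSpace W] [Nontrivial W]
    {i : H →L[ℝ] W} {μ : Measure W} (hμ : IsAbstractWienerSpace i μ) :
    ∃ e : W →L[ℝ] ℝ, ∀ c, μ (e ⁻¹' {c}) = 0 := by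
  obtain ⟨w, hw⟩ := exists_ne (0 : W)
  obtain ⟨e, -, he⟩ := exists_dual_vector ℝ w (norm_ne_zero_iff.2 hw)
  -- If `e` vanished on the dense image of `H`, it would vanish at `w`, where its value is `‖w‖`.
  have hne : e.comp i ≠ 0 := by
    intro h0
    have hz : (e : W → ℝ) = fun _ => 0 := hμ.denseRange.equalizer e.continuous continuous_const
      (funext fun x => by simpa using DFunLike.congr_fun h0 x)
    rw [hz] at he
    exact hw (norm_eq_zero.1 (by simpa using he.symm))
  have := nullSingletonClass_gaussianReal (μ := 0) (v := ‖e.comp i‖₊ ^ 2)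
    (pow_ne_zero 2 (nnnorm_ne_zero_iff.2 hne))
  refine ⟨e, fun c => ?_⟩
  rw [← Measure.map_apply e.continuous.measurable (measurableSet_singleton c), hμ.map_dual]
  exact measure_singleton c

theorem IsAbstractWienerSpace.exists_path {H W : Type*}
    [NormedAddCommGroup H] [InnerProductSpace ℝ H]
    [NormedAddCommGroup W] [NormedSpace ℝ W] [CompleteSpace W] [SecondCountableTopology W]
    [MeasurableSpace W] [BorelSpace W]
    {i : H →L[ℝ] W} {μ : Measure W} (hμ : IsAbstractWienerSpace i μ)
    {T : W → W} (hT : IsInvertibleRotation μ T) :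
    ∃ R : I → W → W, (∀ θ : I, IsInvertibleRotation μ (R θ)) ∧ R 0 = id ∧ R 1 = T ∧
      ∀ θ : I, Tendsto (fun η : I => ∫⁻ w, ‖R η w - R θ w‖ₑ ∂μ) (𝓝 θ) (𝓝 0) := by
  rcases subsingleton_or_nontrivial W with hW | hW
  · refine ⟨fun _ => id, fun _ => .refl_id μ, rfl, Subsingleton.elim _ _, fun θ => ?_⟩
    simp
  have := hμ.isGaussian
  obtain ⟨e, he⟩ := hμ.exists_dual_measure_fiber_eq_zero
  have hint : ∫⁻ w, ‖w‖ₑ ∂μ ≠ ∞ := (IsGaussian.integrable_id (μ := μ)).2.ne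
  -- The sigmoid is injective into `(0, 1)`: no atoms appear, and the sublevel sets at `0` and `1`
  -- are exactly `∅` and `W`, so the endpoints are right everywhere and not just almost everywhere.
  refine exists_path_of_measure_fiber_eq_zero hint (g := fun w => Real.sigmoid (e w))
    (Real.sigmoid_monotone.measurable.comp e.continuous.measurable)
    (fun w => Real.sigmoid_nonneg _) (fun w => Real.sigmoid_lt_one _) (fun c => ?_) hT
  by_cases hc : ∃ x, Real.sigmoid x = c
  · obtain ⟨x, rfl⟩ := hc
    refine measure_mono_null (fun w hw => ?_) (he x)
    exact Real.sigmoid_injective hw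
  · refine measure_mono_null (fun w hw => ?_) (measure_empty (μ := μ))
    exact hc ⟨e w, hw⟩

theorem RotationGroup.pathConnectedSpace {W : Type*} [NormedAddCommGroup W] [MeasurableSpace W]
    [BorelSpace W] [SecondCountableTopology W] {μ : Measure W}
    (h : ∀ T : W → W, IsInvertibleRotation μ T →
      ∃ R : I → W → W, (∀ θ : I, IsInvertibleRotation μ (R θ)) ∧ R 0 = id ∧ R 1 = T ∧
        ∀ θ : I, Tendsto (fun η : I => ∫⁻ w, ‖R η w - R θ w‖ₑ ∂μ) (𝓝 θ) (𝓝 0)) :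
    PathConnectedSpace (RotationGroup μ) := by
  have hjoin : ∀ t : RotationGroup μ, Joined 1 t := by
    rintro ⟨T, hT⟩
    obtain ⟨R, hR, h0, h1, hlim⟩ := h T hT
    refine ⟨⟨⟨fun θ => Quotient.mk _ ⟨R θ, hR θ⟩, ?_⟩, ?_, ?_⟩⟩
    · refine continuous_iff_continuousAt.2 fun θ => ?_
      exact tendsto_iff_edist_tendsto_0.2 (hlim θ)
    · exact congrArg (Quotient.mk _) (Subtype.ext h0)
    · exact congrArg (Quotient.mk _) (Subtype.ext h1)
  exact ⟨⟨1⟩, fun s t => (hjoin s).symm.trans (hjoin t)⟩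

theorem theorem6p1 {H W : Type*}
    [NormedAddCommGroup H] [InnerProductSpace ℝ H] [CompleteSpace H] [SecondCountableTopology H]
    [NormedAddCommGroup W] [NormedSpace ℝ W] [CompleteSpace W] [SecondCountableTopology W]
    [MeasurableSpace W] [BorelSpace W]
    (i : H →L[ℝ] W) (μ : Measure W) (hμ : IsAbstractWienerSpace i μ) :
    (∀ T : W → W, IsInvertibleRotation μ T →
      ∃ R : I → W → W,
        (∀ θ : I, IsInvertibleRotation μ (R θ)) ∧ R 0 = id ∧ R 1 = T ∧
        ∀ θ : I, Tendsto (fun η : I => ∫⁻ w, ‖R η w - R θ w‖ₑ ∂μ) (𝓝 θ) (𝓝 0)) ∧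
    ConnectedSpace (RotationGroup μ) := by
  have h := fun T (hT : IsInvertibleRotation μ T) => hμ.exists_path hT
  have := RotationGroup.pathConnectedSpace h
  exact ⟨h, inferInstance⟩
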